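/- Consider a discrete-time linear system $$x_{t+1}=Ax_t+Bw_t,\qquad y_t=Cx_t+Dw_t,\qquad z_t=Lx_t,$$ with real matrices $A\in\mathbb R^{n\times n}$, $B\in\mathbb R^{n\times m}$, $C\in\mathbb R^{p\times n}$, $D\in\mathbb R^{p\times m}$, $L\in\mathbb R^{q\times n}$, $q\ge 1$, where $A$ is stable (all its eigenvalues have modulus less than $1$). (For several systems, the statement applies to each of them separately, with the same $\lambda$.) Let $S$ be the diagonal $0$-$1$ matrix selecting a set of coordinates of $\mathbb R^n$, let $\rho>0$ and $\mu,\lambda\in\mathbb R$. For a filter $$\hat x_{t+1}=F\hat x_t+Gy_t,\qquad \hat z_t=H\hat x_t+Ky_t$$ with state in $\mathbb R^n$, put $$\tilde A=\begin{bmatrix}A&0\\GC&F\end{bmatrix},\quad \tilde B=\begin{bmatrix}B\\GD\end{bmatrix},\quad \tilde C=\begin{bmatrix}L-KC&-H\end{bmatrix},\quad \tilde D=-KD.$$ The design constraints are that $F$ is stable and $$\|\tilde C(zI-\tilde A)^{-1}\tilde B+\tilde D\|_2^2\le\mu,\qquad \rho^2\,\|H(zI-F)^{-1}GCS+KCS\|_\infty^2\le\lambda,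 \tag{1}$$ both norms being finite, where $$\|\mathcal G\|_2=\Big(\tfrac1{2\pi}\int_{-\pi}^{\pi}\operatorname{Tr}\big(\mathcal G(e^{i\omega})^*\mathcal G(e^{i\omega})\big)\,d\omega\Big)^{1/2},\qquad \|\mathcal G\|_\infty=\operatorname*{ess\,sup}_{\omega\in[-\pi,\pi)}\sigma_{\max}(\mathcal G(e^{i\omega})).$$ Consider the following conditions on real matrices $W\in\mathbb R^{q\times q}$, $Y,Z,\hat F\in\mathbb R^{n\times n}$, $\hat G\in\mathbb R^{n\times p}$, $\hat H\in\mathbb R^{q\times n}$, $\hat K\in\mathbb R^{q\times p}$, where $*$ denotes the transpose of the symmetric block and $\succ0$ means symmetric positive definite: $\operatorname{Tr}(W)<\mu$, $$\begin{bmatrix}W&L-\hat KC-\hat H&L-\hat KC&-\hat KD\\ *&Z&Z&0\\ *&*&Y&0\\ *&*&*&I\end{bmatrix}\succ0,$$ $$\begin{bmatrix}Z&Z&ZA&ZA&ZB\\ *&Y&YA+\hat GC+\hat F&YA+\hat GC&YB+\hat GD\\ *&*&Z&Z&0\\ *&*&*&Y&0\\ *&*&*&*&I\end{bmatrix}\succ0,$$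 $$\begin{bmatrix}Z&Z&0&0&0&0\\ *&Y&0&\hat F&0&\hat GCS\\ *&*&\frac{\lambda}{\rho^2}I&\hat H&0&\hat KCS\\ *&*&*&Z&Z&0\\ *&*&*&*&Y&0\\ *&*&*&*&*&I\end{bmatrix}\succ0. \tag{2}$$ Theorem. (a) If there exist $W,Y,Z,\hat F,\hat G,\hat H,\hat K$ satisfying (2) (all the conditions above), then there exist filter matrices $F\in\mathbb R^{n\times n}$, $G\in\mathbb R^{n\times p}$, $H\in\mathbb R^{q\times n}$, $K\in\mathbb R^{q\times p}$ with $F$ stable satisfying (1). (b) For any $W,Y,Z,\hat F,\hat G,\hat H,\hat K$ satisfying these conditions, there exist nonsingular $U,V\in\mathbb R^{n\times n}$ with $VU^T=I-YZ^{-1}$, and for every such pair $U,V$ the matrices $$F=V^{-1}\hat FZ^{-1}U^{-T},\qquad G=V^{-1}\hat G,\qquad H=\hat HZ^{-1}U^{-T},\qquad K=\hat K$$ define a stable filter satisfying (1). -/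

import Mathlib

open MeasureTheory
open scoped Matrix ENNReal

/-- A real square matrix is stable in discrete time when all its complex eigenvalues lie in the open
unit disc. -/
def IsStableMatrix {n : Type*} [Fintype n] [DecidableEq n] (A : Matrix n n ℝ) : Prop :=
  ∀ z ∈ spectrum ℂ (A.map Complex.ofReal), ‖z‖ < 1

/-- The transfer function `C (z I - A)⁻¹ B + D` of the discrete-time system
`x⁺ = A x + B u`, `y = C x + D u`. -/
noncomputable def transferFunction {n m q : Type*} [Fintype n] [DecidableEq n]
    (A : Matrix n n ℝ) (B : Matrix n m ℝ) (C : Matrix q n ℝ) (D : Matrix q m ℝ) (z : ℂ) :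
    Matrix q m ℂ :=
  C.map Complex.ofReal * (z • (1 : Matrix n n ℂ) - A.map Complex.ofReal)⁻¹ * B.map Complex.ofReal
    + D.map Complex.ofReal

open scoped Matrix.Norms.L2Operator in
/-- The maximum singular value of a complex matrix, that is, its operator norm with respect to the
Euclidean norms. -/
noncomputable def sigmaMax {q m : Type*} [Fintype q] [Fintype m] [DecidableEq m]
    (M : Matrix q m ℂ) : ℝ := ‖M‖

/-- The `H₂` norm `((2π)⁻¹ ∫ Tr (𝒢(e^{iω})ᴴ 𝒢(e^{iω})) dω)^{1/2}`, with `ω` from `-π` to `π`,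
as an extended nonnegative number. The trace is a nonnegative real number. -/
noncomputable def hTwoNorm {q m : Type*} [Fintype q] [Fintype m]
    (𝒢 : ℂ → Matrix q m ℂ) : ℝ≥0∞ :=
  (ENNReal.ofReal (2 * Real.pi)⁻¹ *
    ∫⁻ ω in Set.Ico (-Real.pi) Real.pi,
      ENNReal.ofReal (((𝒢 (Complex.exp (ω * Complex.I)))ᴴ *
        𝒢 (Complex.exp (ω * Complex.I))).trace).re) ^ (1 / 2 : ℝ)

/-- The `H_∞` norm, the essential supremum of `σ_max (𝒢(e^{iω}))` over `ω ∈ [-π, π)`,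
as an extended nonnegative number. -/
noncomputable def hInfNorm {q m : Type*} [Fintype q] [Fintype m] [DecidableEq m]
    (𝒢 : ℂ → Matrix q m ℂ) : ℝ≥0∞ :=
  essSup (fun ω : ℝ => ENNReal.ofReal (sigmaMax (𝒢 (Complex.exp (ω * Complex.I)))))
    (volume.restrict (Set.Ico (-Real.pi) Real.pi))

/-- The diagonal 0-1 matrix that keeps the coordinates in `s` and sets the others to zero. -/
def selectionMatrix {n : Type*} [DecidableEq n] (s : Finset n) : Matrix n n ℝ :=
  Matrix.diagonal fun j => if j ∈ s then 1 else 0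

/-- The transfer function from the noise `w` to the estimation error `e = L x - ẑ`, for the system
`x⁺ = A x + B w`, `y = C x + D w` and the filter `x̂⁺ = F x̂ + G y`, `ẑ = H x̂ + K y`;
the state is `(x, x̂)`. -/
noncomputable def errorTransfer {n k m p q : Type*} [Fintype n] [DecidableEq n] [Fintype k]
    [DecidableEq k] [Fintype p]
    (A : Matrix n n ℝ) (B : Matrix n m ℝ) (C : Matrix p n ℝ) (D : Matrix p m ℝ) (L : Matrix q n ℝ)
    (F : Matrix k k ℝ) (G : Matrix k p ℝ) (H : Matrix q k ℝ) (K : Matrix q p ℝ) :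
    ℂ → Matrix q m ℂ :=
  transferFunction (Matrix.fromBlocks A 0 (G * C) F) (Matrix.fromRows B (G * D))
    (Matrix.fromCols (L - K * C) (-H)) (-(K * D))

/-- The transfer function `H (z I - F)⁻¹ G C S + K C S` from a deviation of the state trajectory in
the coordinates selected by `S` to the deviation of the filter output. -/
noncomputable def sensitivityTransfer {n k p q : Type*} [Fintype n] [Fintype k]
    [DecidableEq k] [Fintype p] (C : Matrix p n ℝ) (S : Matrix n n ℝ)
    (F : Matrix k k ℝ) (G : Matrix k p ℝ) (H : Matrix q k ℝ) (K : Matrix q p ℝ) :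
    ℂ → Matrix q n ℂ :=
  transferFunction F (G * C * S) H (K * C * S)

/-- The design constraints on a filter `(F, G, H, K)`: it is stable, both norms are finite,
the squared `H₂` norm of the error is at most `μ`, and `ρ²` times the squared `H_∞` norm of the
sensitivity is at most `lam`. -/
def FilterConstraints {n k m p q : Type*} [Fintype n] [DecidableEq n] [Fintype k]
    [DecidableEq k] [Fintype m] [Fintype p] [Fintype q]
    (A : Matrix n n ℝ) (B : Matrix n m ℝ) (C : Matrix p n ℝ) (D : Matrix p m ℝ) (L : Matrix q n ℝ)
    (S : Matrix n n ℝ) (ρ μ lam : ℝ)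
    (F : Matrix k k ℝ) (G : Matrix k p ℝ) (H : Matrix q k ℝ) (K : Matrix q p ℝ) : Prop :=
  IsStableMatrix F ∧
  (hTwoNorm (errorTransfer A B C D L F G H K) ≠ ⊤ ∧
    (hTwoNorm (errorTransfer A B C D L F G H K)).toReal ^ 2 ≤ μ) ∧
  (hInfNorm (sensitivityTransfer C S F G H K) ≠ ⊤ ∧
    ρ ^ 2 * (hInfNorm (sensitivityTransfer C S F G H K)).toReal ^ 2 ≤ lam)

/-- The block matrix `[P, Q; *, R]`, where `*` stands for the transpose of `Q`. -/
def symmBlock {a b : Type*} (P : Matrix a a ℝ) (Q : Matrix a b ℝ) (R : Matrix b b ℝ) :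
    Matrix (a ⊕ b) (a ⊕ b) ℝ :=
  Matrix.fromBlocks P Q Qᵀ R

/-- Concatenation of the blocks of a block row. -/
local infixr:60 " ‖ₘ " => Matrix.fromCols

/-- The linear matrix inequalities of the filter design. In each of the three block matrices the
block rows of the upper triangle are listed from the top, each starting at the diagonal. -/
def FilterLMI {n m p q : Type*} [Fintype n] [DecidableEq n] [DecidableEq m] [Fintype p]
    [Fintype q] [DecidableEq q]
    (A : Matrix n n ℝ) (B : Matrix n m ℝ) (C : Matrix p n ℝ) (D : Matrix p m ℝ) (L : Matrix q n ℝ)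
    (S : Matrix n n ℝ) (ρ μ lam : ℝ)
    (W : Matrix q q ℝ) (Y Z : Matrix n n ℝ)
    (Fh : Matrix n n ℝ) (Gh : Matrix n p ℝ) (Hh : Matrix q n ℝ) (Kh : Matrix q p ℝ) : Prop :=
  W.trace < μ ∧
  (symmBlock W ((L - Kh * C - Hh) ‖ₘ (L - Kh * C) ‖ₘ (-(Kh * D)))
    (symmBlock Z (Z ‖ₘ (0 : Matrix n m ℝ))
    (symmBlock Y (0 : Matrix n m ℝ)
    (1 : Matrix m m ℝ)))).PosDef ∧
  (symmBlock Z (Z ‖ₘ (Z * A) ‖ₘ (Z * A) ‖ₘ (Z * B))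
    (symmBlock Y ((Y * A + Gh * C + Fh) ‖ₘ (Y * A + Gh * C) ‖ₘ (Y * B + Gh * D))
    (symmBlock Z (Z ‖ₘ (0 : Matrix n m ℝ))
    (symmBlock Y (0 : Matrix n m ℝ)
    (1 : Matrix m m ℝ))))).PosDef ∧
  (symmBlock Z (Z ‖ₘ (0 : Matrix n q ℝ) ‖ₘ (0 : Matrix n n ℝ) ‖ₘ (0 : Matrix n n ℝ) ‖ₘ
      (0 : Matrix n n ℝ))
    (symmBlock Y ((0 : Matrix n q ℝ) ‖ₘ Fh ‖ₘ (0 : Matrix n n ℝ) ‖ₘ (Gh * C * S))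
    (symmBlock ((lam / ρ ^ 2) • (1 : Matrix q q ℝ)) (Hh ‖ₘ (0 : Matrix q n ℝ) ‖ₘ (Kh * C * S))
    (symmBlock Z (Z ‖ₘ (0 : Matrix n n ℝ))
    (symmBlock Y (0 : Matrix n n ℝ)
    (1 : Matrix n n ℝ)))))).PosDef

/-!
A filter of the form in the theorem turns the linear matrix inequalities into a Lyapunov/Gramian
certificate and a bounded real certificate for its closed loop.

With `T = Z⁻¹ U⁻ᵀ` one has `(Z - Y) T = V`. Hence, after the change of coordinates
`(x, x̂) ↦ (T x̂, x - T x̂)`, the first two matrix inequalities are the standard `H₂` inequalities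
of the error system with a Lyapunov matrix `P` (`FilterLMI.hTwoNorm_errorTransfer`), and the third,
restricted to the filter state, is the bounded real inequality of the sensitivity
(`FilterLMI.sensitivity_fromBlocks_posDef`). What remains are two facts on linear systems.

* The `H₂` bound (`hTwoNorm_transferFunction_of_posDef`). By Schur complements `Q = P⁻¹` satisfies
  `A Q Aᵀ + B Bᵀ ≼ Q` and `C Q Cᵀ + D Dᵀ ≼ W`. No series for the Gramian is needed: on the unit
  circle `tr (𝒢ᴴ 𝒢) ≤ tr W + 2 Re tr (C R (A Q Cᵀ + B Dᵀ))` with `R = (z - A)⁻¹`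
  (`re_trace_conjTranspose_mul_self_le`), and the resolvent has mean zero over the circle
  (`IsStableMatrix.integral_resolvent_eq_zero`), by the mean value property in the variable `z⁻¹`.
* The bounded real lemma (`hInfNorm_transferFunction_of_posDef`). At each frequency the matrix
  inequality is evaluated at one vector made from the state, the input and the output
  (`re_star_dotProduct_le_of_posSemidef`).

Stability comes from the Lyapunov part of the inequalities (`isStableMatrix_of_posDef`), and
invertible `U`, `V` exist because `Y - Z` is positive definite (`FilterLMI.sub_posDef`).
-/

section

open Matrix
open scoped ComplexOrder

/-! ### Complexification of real matrices -/

theorem map_ofReal_mul {a b c : Type*} [Fintype b] (M : Matrix a b ℝ) (N : Matrix b c ℝ) :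
    (M * N).map Complex.ofReal = M.map Complex.ofReal * N.map Complex.ofReal :=
  Matrix.map_mul (f := Complex.ofRealHom)

theorem map_ofReal_transpose {a b : Type*} (M : Matrix a b ℝ) :
    Mᵀ.map Complex.ofReal = (M.map Complex.ofReal)ᴴ := by
  ext i j
  simp

theorem map_ofReal_zero {a b : Type*} : (0 : Matrix a b ℝ).map Complex.ofReal = 0 :=
  Matrix.map_zero _ Complex.ofReal_zero

theorem map_ofReal_one {a : Type*} [DecidableEq a] :
    (1 : Matrix a a ℝ).map Complex.ofReal = 1 :=
  Matrix.map_one _ Complex.ofReal_zero Complex.ofReal_one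

theorem Matrix.PosSemidef.map_ofReal {k : Type*} [Fintype k] {M : Matrix k k ℝ}
    (hM : M.PosSemidef) : (M.map Complex.ofReal).PosSemidef := by
  classical
  open scoped MatrixOrder in
  obtain ⟨a, rfl⟩ := CStarAlgebra.nonneg_iff_eq_star_mul_self.mp hM.nonneg
  rw [map_ofReal_mul, star_eq_conjTranspose, conjTranspose_eq_transpose_of_trivial,
    map_ofReal_transpose]
  exact posSemidef_conjTranspose_mul_self _

theorem Matrix.PosDef.map_ofReal {k : Type*} [Fintype k] {M : Matrix k k ℝ}
    (hM : M.PosDef) : (M.map Complex.ofReal).PosDef := by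
  classical
  rw [hM.posSemidef.map_ofReal.posDef_iff_det_ne_zero]
  have h : (M.map Complex.ofReal).det = (M.det : ℂ) := (Complex.ofRealHom.map_det M).symm
  rw [h]
  exact_mod_cast hM.det_pos.ne'

/-! ### Quadratic forms of block matrices -/

/-- Congruence of a block matrix with a block diagonal matrix with full column rank. -/
theorem Matrix.PosDef.fromBlocks_congr {a b c d : Type*} [Fintype a] [Fintype b] [Fintype c]
    [Fintype d] [DecidableEq c] [DecidableEq d] {X : Matrix a a ℝ} {Y : Matrix a b ℝ}
    {Z : Matrix b b ℝ} (h : (fromBlocks X Y Yᵀ Z).PosDef)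
    {E₁ : Matrix a c ℝ} {E₂ : Matrix b d ℝ} {K₁ : Matrix c a ℝ} {K₂ : Matrix d b ℝ}
    (h₁ : K₁ * E₁ = 1) (h₂ : K₂ * E₂ = 1) :
    (fromBlocks (E₁ᵀ * X * E₁) (E₁ᵀ * Y * E₂) (E₁ᵀ * Y * E₂)ᵀ (E₂ᵀ * Z * E₂)).PosDef := by
  have hinj : Function.Injective (fromBlocks E₁ 0 0 E₂).mulVec := by
    refine Function.LeftInverse.injective (g := (fromBlocks K₁ 0 0 K₂).mulVec) fun v => ?_
    rw [mulVec_mulVec, fromBlocks_multiply]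
    simp [h₁, h₂]
  have := h.conjTranspose_mul_mul_same hinj
  rw [conjTranspose_eq_transpose_of_trivial, fromBlocks_transpose, fromBlocks_multiply,
    fromBlocks_multiply] at this
  simpa [Matrix.mul_assoc] using this

theorem star_sumElim {a b : Type*} (v : a → ℂ) (w : b → ℂ) :
    star (Sum.elim v w) = Sum.elim (star v) (star w) := by
  ext (i | i) <;> rfl

theorem re_star_dotProduct_fromBlocks_mulVec {a b : Type*} [Fintype a] [Fintype b]
    (X : Matrix a a ℂ) (Y : Matrix a b ℂ) (Z : Matrix b b ℂ) (v : a → ℂ) (w : b → ℂ) :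
    (star (Sum.elim v w) ⬝ᵥ fromBlocks X Y Yᴴ Z *ᵥ Sum.elim v w).re =
      (star v ⬝ᵥ X *ᵥ v).re + (star w ⬝ᵥ Z *ᵥ w).re + 2 * (star v ⬝ᵥ Y *ᵥ w).re := by
  have hc : star w ⬝ᵥ Yᴴ *ᵥ v = star (star v ⬝ᵥ Y *ᵥ w) := by
    rw [star_dotProduct, star_mulVec, conjTranspose_conjTranspose, dotProduct_mulVec]
  have hre : (star (star v ⬝ᵥ Y *ᵥ w)).re = (star v ⬝ᵥ Y *ᵥ w).re := Complex.conj_re _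
  rw [fromBlocks_mulVec, star_sumElim, sumElim_dotProduct_sumElim]
  simp only [dotProduct_add, Sum.elim_comp_inl, Sum.elim_comp_inr, Complex.add_re, hc, hre]
  ring

/-! ### Stability -/

/-- The Lyapunov inequality `P - Aᴴ P A ≻ 0`, in its Schur complement form, bounds the eigenvalues
of `A`: the form is tested at `(-z v, v)` for an eigenvector `v`. -/
theorem norm_lt_one_of_posDef_fromBlocks {k : Type*} [Fintype k] {P A : Matrix k k ℂ}
    (h : (fromBlocks P (P * A) (P * A)ᴴ P).PosDef) {z : ℂ} {v : k → ℂ} (hv : v ≠ 0)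
    (hz : A *ᵥ v = z • v) : ‖z‖ < 1 := by
  have hP : P.PosDef := h.submatrix (e := Sum.inl) Sum.inl_injective
  have hp : 0 < (star v ⬝ᵥ P *ᵥ v).re := (Complex.lt_def.1 (hP.dotProduct_mulVec_pos hv)).1
  have hne : Sum.elim (-(z • v)) v ≠ 0 := fun h0 =>
    hv (by simpa using congrArg (fun f => f ∘ Sum.inr) h0)
  have h1 := (Complex.lt_def.1 (h.dotProduct_mulVec_pos hne)).1
  have h2 : (star (-(z • v)) ⬝ᵥ P *ᵥ (-(z • v))).re = ‖z‖ ^ 2 * (star v ⬝ᵥ P *ᵥ v).re := by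
    rw [star_neg, mulVec_neg, neg_dotProduct_neg, star_smul, mulVec_smul, smul_dotProduct,
      dotProduct_smul, smul_smul, Complex.star_def, Complex.conj_mul', ← Complex.ofReal_pow,
      smul_eq_mul, Complex.re_ofReal_mul]
  have h3 : (star (-(z • v)) ⬝ᵥ (P * A) *ᵥ v).re = -(‖z‖ ^ 2 * (star v ⬝ᵥ P *ᵥ v).re) := by
    rw [← h2, ← mulVec_mulVec, hz, mulVec_neg, dotProduct_neg, Complex.neg_re, neg_neg]
  rw [re_star_dotProduct_fromBlocks_mulVec, h2, h3, Complex.zero_re] at h1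
  by_contra! hz1
  nlinarith [one_le_pow₀ hz1 (n := 2)]

theorem isStableMatrix_of_posDef {k : Type*} [Fintype k] [DecidableEq k] {P A : Matrix k k ℝ}
    (h : (fromBlocks P (P * A) (P * A)ᵀ P).PosDef) : IsStableMatrix A := by
  intro z hz
  rw [spectrum.mem_iff, isUnit_iff_isUnit_det, isUnit_iff_ne_zero, not_not,
    ← exists_mulVec_eq_zero_iff] at hz
  obtain ⟨v, hv, hz⟩ := hz
  have h' := h.map_ofReal
  rw [fromBlocks_map, map_ofReal_transpose, map_ofReal_mul] at h'
  refine norm_lt_one_of_posDef_fromBlocks h' hv ?_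
  rw [sub_mulVec, sub_eq_zero, Algebra.algebraMap_eq_smul_one, smul_mulVec, one_mulVec] at hz
  exact hz.symm

/-! ### The bounded real inequality -/

/-- The bounded real inequality at one frequency: if `z x = A x + B u` with `|z| = 1`, testing the
form at `((-z x, -γ⁻¹ (C x + D u)), (x, u))` leaves `|u|² - γ⁻¹ |C x + D u|²`. -/
theorem re_star_dotProduct_le_of_posSemidef {k m q : Type*} [Fintype k] [Fintype m] [Fintype q]
    [DecidableEq m] [DecidableEq q] {P A : Matrix k k ℂ} {B : Matrix k m ℂ} {C : Matrix q k ℂ}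
    {D : Matrix q m ℂ} {γ : ℝ} (hγ : 0 < γ)
    (h : (fromBlocks (fromBlocks P 0 0 ((γ : ℂ) • 1)) (fromBlocks (P * A) (P * B) C D)
      (fromBlocks (P * A) (P * B) C D)ᴴ (fromBlocks P 0 0 1)).PosSemidef)
    {z : ℂ} (hz : ‖z‖ = 1) {x : k → ℂ} {u : m → ℂ} (hx : A *ᵥ x + B *ᵥ u = z • x) :
    (star (C *ᵥ x + D *ᵥ u) ⬝ᵥ (C *ᵥ x + D *ᵥ u)).re ≤ γ * (star u ⬝ᵥ u).re := by
  set y := C *ᵥ x + D *ᵥ u with hy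
  have h1 := (Complex.le_def.1 (h.dotProduct_mulVec_nonneg
    (Sum.elim (Sum.elim (-(z • x)) (-((γ⁻¹ : ℝ) : ℂ) • y)) (Sum.elim x u)))).1
  have hPx : (P * A) *ᵥ x + (P * B) *ᵥ u = P *ᵥ (z • x) := by
    rw [← mulVec_mulVec, ← mulVec_mulVec, ← mulVec_add, hx]
  have hγ' : ((γ⁻¹ : ℝ) : ℂ) * γ = 1 := by exact_mod_cast inv_mul_cancel₀ hγ.ne'
  have hzP : star (z • x) ⬝ᵥ P *ᵥ (z • x) = star x ⬝ᵥ P *ᵥ x := by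
    rw [star_smul, mulVec_smul, smul_dotProduct, dotProduct_smul, smul_smul, Complex.star_def,
      Complex.conj_mul', hz, Complex.ofReal_one, one_pow, one_smul]
  have t1 : star (Sum.elim (-(z • x)) (-((γ⁻¹ : ℝ) : ℂ) • y)) ⬝ᵥ
      fromBlocks P 0 0 ((γ : ℂ) • 1) *ᵥ Sum.elim (-(z • x)) (-((γ⁻¹ : ℝ) : ℂ) • y) =
      star x ⬝ᵥ P *ᵥ x + ((γ⁻¹ : ℝ) : ℂ) * (star y ⬝ᵥ y) := by
    rw [fromBlocks_mulVec, star_sumElim, sumElim_dotProduct_sumElim]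
    simp only [Sum.elim_comp_inl, Sum.elim_comp_inr, zero_mulVec, add_zero, zero_add,
      mulVec_neg, star_neg, neg_dotProduct_neg, hzP, smul_mulVec, one_mulVec, neg_zero]
    rw [star_smul, smul_dotProduct, smul_smul, dotProduct_smul, smul_eq_mul, smul_eq_mul,
      star_neg, Complex.star_def, Complex.conj_ofReal]
    linear_combination ((γ⁻¹ : ℝ) : ℂ) * (star y ⬝ᵥ y) * hγ'
  have t2 : star (Sum.elim x u) ⬝ᵥ fromBlocks P 0 0 1 *ᵥ Sum.elim x u =
      star x ⬝ᵥ P *ᵥ x + star u ⬝ᵥ u := by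
    rw [fromBlocks_mulVec, star_sumElim, sumElim_dotProduct_sumElim]
    simp only [Sum.elim_comp_inl, Sum.elim_comp_inr, zero_mulVec, add_zero, zero_add, one_mulVec]
  have t3 : star (Sum.elim (-(z • x)) (-((γ⁻¹ : ℝ) : ℂ) • y)) ⬝ᵥ
      fromBlocks (P * A) (P * B) C D *ᵥ Sum.elim x u =
      -(star x ⬝ᵥ P *ᵥ x) - ((γ⁻¹ : ℝ) : ℂ) * (star y ⬝ᵥ y) := by
    rw [fromBlocks_mulVec, star_sumElim, sumElim_dotProduct_sumElim]
    simp only [Sum.elim_comp_inl, Sum.elim_comp_inr, hPx, ← hy, star_neg, neg_dotProduct, hzP]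
    rw [star_smul, smul_dotProduct, smul_eq_mul, star_neg, Complex.star_def, Complex.conj_ofReal]
    ring
  rw [re_star_dotProduct_fromBlocks_mulVec, t1, t2, t3] at h1
  simp only [Complex.add_re, Complex.sub_re, Complex.neg_re, Complex.re_ofReal_mul,
    Complex.zero_re] at h1
  have h2 : γ⁻¹ * (star y ⬝ᵥ y).re ≤ (star u ⬝ᵥ u).re := by linarith
  rwa [inv_mul_le_iff₀ hγ] at h2

/-! ### The `H₂` norm -/

/-- If `Q` is a supersolution of the Lyapunov equation `Q = A Q Aᴴ + B Bᴴ` and `W` dominates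
`C Q Cᴴ + D Dᴴ`, then on the unit circle the squared Frobenius norm of the transfer function is at
most `tr W` plus a term linear in the resolvent `R`. The reason is the identity
`X Q Xᴴ = (X A + C) Q (X A + C)ᴴ` for `X = C R`. -/
theorem re_trace_conjTranspose_mul_self_le {k m q : Type*} [Fintype k] [Fintype m] [Fintype q]
    [DecidableEq k] {A Q R : Matrix k k ℂ} {B : Matrix k m ℂ} {C : Matrix q k ℂ}
    {D : Matrix q m ℂ} {W : Matrix q q ℂ} (hQH : Qᴴ = Q)
    (hQ : (Q - A * Q * Aᴴ - B * Bᴴ).PosSemidef) (hW : (W - C * Q * Cᴴ - D * Dᴴ).PosSemidef)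
    {z : ℂ} (hz : ‖z‖ = 1) (hR : R * (z • 1 - A) = 1) :
    (((C * R * B + D)ᴴ * (C * R * B + D)).trace).re ≤
      W.trace.re + 2 * ((C * R * (A * Q * Cᴴ + B * Dᴴ)).trace).re := by
  set X := C * R with hX
  have hXA : z • X = X * A + C := by
    have h : X * (z • 1 - A) = C := by rw [hX, Matrix.mul_assoc, hR, Matrix.mul_one]
    rw [Matrix.mul_sub, Matrix.mul_smul, Matrix.mul_one] at h
    rw [← h]; abel
  have hXQ : X * Q * Xᴴ = (X * A + C) * Q * (X * A + C)ᴴ := by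
    rw [← hXA, conjTranspose_smul, Matrix.smul_mul, Matrix.smul_mul, Matrix.mul_smul, smul_smul,
      Complex.star_def, Complex.mul_conj', hz]
    simp
  have key : (X * B + D) * (X * B + D)ᴴ + X * (Q - A * Q * Aᴴ - B * Bᴴ) * Xᴴ
      + (W - C * Q * Cᴴ - D * Dᴴ) =
      W + X * (A * Q * Cᴴ + B * Dᴴ) + (X * (A * Q * Cᴴ + B * Dᴴ))ᴴ := by
    rw [Matrix.mul_sub, Matrix.mul_sub, Matrix.sub_mul, Matrix.sub_mul, hXQ]
    simp only [conjTranspose_add, conjTranspose_mul, conjTranspose_conjTranspose, Matrix.add_mul,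
      Matrix.mul_add, Matrix.mul_assoc, hQH]
    abel
  have h1 := (Complex.le_def.1 (hQ.mul_mul_conjTranspose_same X).trace_nonneg).1
  have h2 := (Complex.le_def.1 hW.trace_nonneg).1
  have h3 := congrArg (fun M => (trace M).re) key
  simp only [trace_add, trace_conjTranspose, Complex.add_re, Complex.star_def,
    Complex.conj_re] at h3
  rw [trace_mul_comm]
  simp only [Complex.zero_re] at h1 h2
  linarith

/-- For a stable matrix, `1 - w A` is invertible for `w` in the closed unit disc. -/
theorem IsStableMatrix.isUnit_one_sub_smul {k : Type*} [Fintype k] [DecidableEq k]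
    {A : Matrix k k ℝ} (hA : IsStableMatrix A) {w : ℂ} (hw : ‖w‖ ≤ 1) :
    IsUnit (1 - w • A.map Complex.ofReal) := by
  rcases eq_or_ne w 0 with rfl | h0
  · simp
  have h1 : w⁻¹ ∉ spectrum ℂ (A.map Complex.ofReal) := fun h => by
    have := hA _ h
    rw [norm_inv, inv_lt_one_iff₀] at this
    rcases this with h | h
    · exact h0 (norm_le_zero_iff.1 h)
    · exact absurd hw h.not_ge
  rw [spectrum.mem_iff, not_not] at h1
  have h2 : (1 : Matrix k k ℂ) - w • A.map Complex.ofReal =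
      (Units.mk0 w h0) • (algebraMap ℂ (Matrix k k ℂ) w⁻¹ - A.map Complex.ofReal) := by
    rw [Units.smul_def, smul_sub, Algebra.algebraMap_eq_smul_one, Units.val_mk0, smul_smul,
      mul_inv_cancel₀ h0, one_smul]
  rw [h2]
  exact h1.smul _

theorem IsStableMatrix.isUnit_smul_one_sub {k : Type*} [Fintype k] [DecidableEq k]
    {A : Matrix k k ℝ} (hA : IsStableMatrix A) {z : ℂ} (hz : ‖z‖ = 1) :
    IsUnit (z • (1 : Matrix k k ℂ) - A.map Complex.ofReal) := by
  have h1 : z ∉ spectrum ℂ (A.map Complex.ofReal) := fun h => (hA _ h).ne hz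
  rwa [spectrum.mem_iff, not_not, Algebra.algebraMap_eq_smul_one] at h1

open scoped Matrix.Norms.Operator in
theorem IsStableMatrix.differentiableAt_inv {k : Type*} [Fintype k] [DecidableEq k]
    {A : Matrix k k ℝ} (hA : IsStableMatrix A) {w : ℂ} (hw : ‖w‖ ≤ 1) (l : Matrix k k ℂ →ₗ[ℂ] ℂ) :
    DifferentiableAt ℂ (fun w : ℂ => l (w • (1 - w • A.map Complex.ofReal)⁻¹)) w := by
  have h1 : DifferentiableAt ℂ (fun w : ℂ => (1 - w • A.map Complex.ofReal)⁻¹) w := by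
    simp only [nonsing_inv_eq_ringInverse]
    obtain ⟨u, hu⟩ := hA.isUnit_one_sub_smul hw
    refine DifferentiableAt.comp (g := Ring.inverse) w ?_ (by fun_prop)
    rw [← hu]
    exact differentiableAt_inverse u.isUnit
  have h2 : DifferentiableAt ℂ (fun w : ℂ => w • (1 - w • A.map Complex.ofReal)⁻¹) w :=
    differentiableAt_id.smul h1
  exact (LinearMap.toContinuousLinearMap l).differentiableAt.comp w h2

theorem inv_smul_one_sub_eq {k : Type*} [Fintype k] [DecidableEq k] (M : Matrix k k ℂ) {z : ℂ}
    (hz : z ≠ 0) : (z • 1 - M)⁻¹ = z⁻¹ • (1 - z⁻¹ • M)⁻¹ := by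
  have h : z • 1 - M = (Units.mk0 z hz) • (1 - z⁻¹ • M) := by
    rw [Units.smul_def, smul_sub, Units.val_mk0, smul_smul, mul_inv_cancel₀ hz, one_smul]
  by_cases hu : IsUnit (1 - z⁻¹ • M).det
  · rw [h, inv_smul' (1 - z⁻¹ • M) (Units.mk0 z hz) hu, Units.smul_def]; simp
  · have hu' : ¬ IsUnit (z • 1 - M).det := by
      rw [← isUnit_iff_isUnit_det] at hu ⊢
      rw [h]
      exact fun h' => hu (by have := h'.smul (Units.mk0 z hz)⁻¹; rwa [inv_smul_smul] at this)
    rw [nonsing_inv_apply_not_isUnit _ hu, nonsing_inv_apply_not_isUnit _ hu', smul_zero]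

theorem IsStableMatrix.continuous_resolvent {k : Type*} [Fintype k] [DecidableEq k]
    {A : Matrix k k ℝ} (hA : IsStableMatrix A) (l : Matrix k k ℂ →ₗ[ℂ] ℂ) :
    Continuous fun ω : ℝ => l (Complex.exp (ω * Complex.I) • 1 - A.map Complex.ofReal)⁻¹ := by
  refine continuous_iff_continuousAt.2 fun ω => ?_
  have h := (hA.differentiableAt_inv (w := Complex.exp (-(ω * Complex.I)))
    (by rw [Complex.norm_exp]; simp) l).continuousAt
  have hc : ContinuousAt (fun ω : ℝ => Complex.exp (-(ω * Complex.I))) ω := by fun_prop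
  refine (ContinuousAt.comp (f := fun ω : ℝ => Complex.exp (-(ω * Complex.I))) h hc).congr
    (.of_forall fun t => ?_)
  simp only [Function.comp_apply]
  rw [inv_smul_one_sub_eq _ (Complex.exp_ne_zero _), Complex.exp_neg]

/-- The resolvent of a stable matrix has mean zero over the unit circle: in the variable
`w = z⁻¹` it is `w (1 - w A)⁻¹`, which is holomorphic on the closed disc and vanishes at the
centre. -/
theorem IsStableMatrix.integral_resolvent_eq_zero {k : Type*} [Fintype k] [DecidableEq k]
    {A : Matrix k k ℝ} (hA : IsStableMatrix A) (l : Matrix k k ℂ →ₗ[ℂ] ℂ) :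
    ∫ ω in -Real.pi..Real.pi,
      l (Complex.exp (ω * Complex.I) • 1 - A.map Complex.ofReal)⁻¹ = 0 := by
  set f : ℂ → ℂ := fun w => l (w • (1 - w • A.map Complex.ofReal)⁻¹) with hf
  have h1 : Real.circleAverage f 0 1 = f 0 := by
    refine circleAverage_of_differentiable_on_off_countable Set.countable_empty ?_ ?_
    · intro w hw
      exact (hA.differentiableAt_inv (by simpa using hw) l).continuousAt.continuousWithinAt
    · intro w hw
      exact hA.differentiableAt_inv (by simpa using (mem_ball_zero_iff.1 hw.1).le) l
  have h2 : ∫ θ in (0 : ℝ)..2 * Real.pi, f (circleMap 0 1 θ) = 0 := by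
    rw [Real.circleAverage_def, show f 0 = 0 by simp [hf], smul_eq_zero] at h1
    exact h1.resolve_left (by positivity)
  have h3 : ∫ θ in -Real.pi..Real.pi, f (circleMap 0 1 θ) = 0 := by
    have hp : Function.Periodic (fun θ => f (circleMap 0 1 θ)) (2 * Real.pi) :=
      fun θ => by simp only [periodic_circleMap 0 1 θ]
    have := hp.intervalIntegral_add_eq (-Real.pi) 0
    rwa [zero_add, h2, show -Real.pi + 2 * Real.pi = Real.pi by ring] at this
  have h4 := intervalIntegral.integral_comp_neg (a := -Real.pi) (b := Real.pi)
    fun θ => f (circleMap 0 1 θ)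
  rw [neg_neg, h3] at h4
  rw [← h4]
  congr 1 with ω
  simp only [hf, circleMap_zero, Complex.ofReal_one, one_mul]
  rw [inv_smul_one_sub_eq _ (Complex.exp_ne_zero _), ← Complex.exp_neg]
  simp

/-- A stable system has `‖𝒢‖₂² ≤ tr W` as soon as some `Q` satisfies `A Q Aᵀ + B Bᵀ ≼ Q` and
`C Q Cᵀ + D Dᵀ ≼ W`. -/
theorem IsStableMatrix.hTwoNorm_transferFunction {k m q : Type*} [Fintype k] [DecidableEq k]
    [Fintype m] [Fintype q] {A Q : Matrix k k ℝ} (hA : IsStableMatrix A) {B : Matrix k m ℝ}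
    {C : Matrix q k ℝ} {D : Matrix q m ℝ} {W : Matrix q q ℝ} (hQT : Qᵀ = Q)
    (hQ : (Q - A * Q * Aᵀ - B * Bᵀ).PosSemidef) (hW : (W - C * Q * Cᵀ - D * Dᵀ).PosSemidef) :
    hTwoNorm (transferFunction A B C D) ≠ ⊤ ∧
      (hTwoNorm (transferFunction A B C D)).toReal ^ 2 ≤ W.trace := by
  have hQ' := hQ.map_ofReal
  have hW' := hW.map_ofReal
  simp only [Matrix.map_sub _ Complex.ofReal_sub, map_ofReal_mul, map_ofReal_transpose] at hQ' hW'
  have hQH : (Q.map Complex.ofReal)ᴴ = Q.map Complex.ofReal := by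
    rw [← map_ofReal_transpose, hQT]
  set Nc : Matrix k q ℂ := A.map Complex.ofReal * Q.map Complex.ofReal * (C.map Complex.ofReal)ᴴ +
    B.map Complex.ofReal * (D.map Complex.ofReal)ᴴ
  -- `l M = tr (C M Nc)`, the linear functional of the resolvent in the pointwise bound `g`
  let l : Matrix k k ℂ →ₗ[ℂ] ℂ := Matrix.traceLinearMap q ℂ ℂ ∘ₗ
    (mulRightLinearMap q ℂ Nc) ∘ₗ (mulLeftLinearMap k ℂ (C.map Complex.ofReal))
  set R : ℝ → Matrix k k ℂ := fun ω =>
    (Complex.exp (ω * Complex.I) • 1 - A.map Complex.ofReal)⁻¹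
  set g : ℝ → ℝ := fun ω => W.trace + 2 * (l (R ω)).re with hg
  set t : ℝ → ℝ := fun ω => (((transferFunction A B C D (Complex.exp (ω * Complex.I)))ᴴ *
        transferFunction A B C D (Complex.exp (ω * Complex.I))).trace).re
  have hz : ∀ ω : ℝ, ‖Complex.exp (ω * Complex.I)‖ = 1 := Complex.norm_exp_ofReal_mul_I
  have htg : ∀ ω, t ω ≤ g ω := by
    intro ω
    have hWt : (W.map Complex.ofReal).trace.re = W.trace := by
      simp [trace]
    have := re_trace_conjTranspose_mul_self_le hQH hQ' hW' (hz ω) (nonsing_inv_mul _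
      ((isUnit_iff_isUnit_det _).1 (hA.isUnit_smul_one_sub (hz ω))))
    rwa [hWt] at this
  have ht0 : ∀ ω, 0 ≤ t ω := fun ω =>
    (Complex.le_def.1 (posSemidef_conjTranspose_mul_self _).trace_nonneg).1
  have hlc : Continuous fun ω => l (R ω) := hA.continuous_resolvent l
  have hlr : Continuous fun ω => 2 * (l (R ω)).re :=
    continuous_const.mul (Complex.continuous_re.comp hlc)
  have hgc : Continuous g := continuous_const.add hlr
  have hgi : ∫ ω in -Real.pi..Real.pi, g ω = 2 * Real.pi * W.trace := by
    have hre : ∫ ω in -Real.pi..Real.pi, (l (R ω)).re = 0 := by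
      have h1 := Complex.reCLM.intervalIntegral_comp_comm
        (hlc.intervalIntegrable (μ := volume) (-Real.pi) Real.pi)
      rw [hA.integral_resolvent_eq_zero l] at h1
      simpa using h1
    rw [hg, intervalIntegral.integral_add (by simp)
      (hlr.intervalIntegrable _ _),
      intervalIntegral.integral_const_mul, hre, intervalIntegral.integral_const, smul_eq_mul]
    ring
  have hpi : -Real.pi ≤ Real.pi := by linarith [Real.pi_pos]
  have hset : ∫ ω in Set.Ico (-Real.pi) Real.pi, g ω = 2 * Real.pi * W.trace := by
    rw [integral_Ico_eq_integral_Ioc, ← intervalIntegral.integral_of_le hpi, hgi]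
  have hint : IntegrableOn g (Set.Ico (-Real.pi) Real.pi) :=
    (hgc.integrableOn_Icc).mono_set Set.Ico_subset_Icc_self
  have hlint : ∫⁻ ω in Set.Ico (-Real.pi) Real.pi, ENNReal.ofReal (t ω) ≤
      ENNReal.ofReal (2 * Real.pi * W.trace) := by
    rw [← hset, ofReal_integral_eq_lintegral_ofReal hint
      (.of_forall fun ω => (ht0 ω).trans (htg ω))]
    exact lintegral_mono fun ω => ENNReal.ofReal_le_ofReal (htg ω)
  -- the mean of `g` is `tr W`, and `g` dominates a nonnegative function
  have hW0 : 0 ≤ W.trace := by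
    have : 0 ≤ ∫ ω in -Real.pi..Real.pi, g ω :=
      intervalIntegral.integral_nonneg hpi fun ω _ => (ht0 ω).trans (htg ω)
    rw [hgi] at this
    exact nonneg_of_mul_nonneg_right this (by positivity)
  have hx : ENNReal.ofReal (2 * Real.pi)⁻¹ *
      ∫⁻ ω in Set.Ico (-Real.pi) Real.pi, ENNReal.ofReal (t ω) ≤ ENNReal.ofReal W.trace := by
    refine (mul_le_mul_right hlint _).trans_eq ?_
    rw [← ENNReal.ofReal_mul (by positivity), inv_mul_cancel_left₀ (by positivity)]
  rw [hTwoNorm]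
  change (_ * ∫⁻ ω in Set.Ico (-Real.pi) Real.pi, ENNReal.ofReal (t ω)) ^ (1 / 2 : ℝ) ≠ ⊤ ∧
    ((_ * ∫⁻ ω in Set.Ico (-Real.pi) Real.pi, ENNReal.ofReal (t ω)) ^ (1 / 2 : ℝ)).toReal ^ 2 ≤ _
  refine ⟨ENNReal.rpow_ne_top_of_nonneg (by norm_num)
    (ne_top_of_le_ne_top ENNReal.ofReal_ne_top hx), ?_⟩
  rw [← ENNReal.toReal_pow, ← ENNReal.rpow_natCast, ← ENNReal.rpow_mul]
  norm_num only [ENNReal.rpow_one, Nat.cast_ofNat]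
  exact ENNReal.toReal_le_of_le_ofReal hW0 hx

/-- Schur complement with respect to the lower right block `diag (P, 1)`. -/
theorem Matrix.PosDef.sub_mul_inv_mul_posSemidef {a k m : Type*} [Fintype a] [Fintype k]
    [DecidableEq k] [Fintype m] [DecidableEq m] {X : Matrix a a ℝ} {M : Matrix a k ℝ}
    {N : Matrix a m ℝ} {P : Matrix k k ℝ}
    (h : (fromBlocks X (fromCols M N) (fromCols M N)ᵀ
      (fromBlocks P 0 0 (1 : Matrix m m ℝ))).PosDef) :
    (X - M * P⁻¹ * Mᵀ - N * Nᵀ).PosSemidef := by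
  have h2 : (fromBlocks P 0 0 (1 : Matrix m m ℝ)).PosDef :=
    h.submatrix (e := Sum.inr) Sum.inr_injective
  have hP : P.PosDef := h2.submatrix (e := Sum.inl) Sum.inl_injective
  have hPu : P * P⁻¹ = 1 := mul_nonsing_inv _ ((isUnit_iff_isUnit_det _).1 hP.isUnit)
  have hinv : (fromBlocks P 0 0 (1 : Matrix m m ℝ))⁻¹ = fromBlocks P⁻¹ 0 0 1 := by
    refine inv_eq_right_inv ?_
    rw [fromBlocks_multiply]
    simp [hPu]
  let := h2.isUnit.invertible
  have h3 := (PosDef.fromBlocks₂₂ X (fromCols M N) h2).1 (by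
    rw [conjTranspose_eq_transpose_of_trivial]; exact h.posSemidef)
  rw [hinv, conjTranspose_eq_transpose_of_trivial, transpose_fromCols, fromCols_mul_fromBlocks,
    fromCols_mul_fromRows] at h3
  simpa [sub_sub] using h3

/-- The `H₂` bound from the pair of linear matrix inequalities, with `Q = P⁻¹` as the
supersolution of the Lyapunov equation. -/
theorem hTwoNorm_transferFunction_of_posDef {k m q : Type*} [Fintype k] [DecidableEq k]
    [Fintype m] [DecidableEq m] [Fintype q] {A P : Matrix k k ℝ} {B : Matrix k m ℝ}
    {C : Matrix q k ℝ} {D : Matrix q m ℝ} {W : Matrix q q ℝ}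
    (h₁ : (fromBlocks W (fromCols C D) (fromCols C D)ᵀ (fromBlocks P 0 0 1)).PosDef)
    (h₂ : (fromBlocks P (fromCols (P * A) (P * B)) (fromCols (P * A) (P * B))ᵀ
      (fromBlocks P 0 0 1)).PosDef) :
    hTwoNorm (transferFunction A B C D) ≠ ⊤ ∧
      (hTwoNorm (transferFunction A B C D)).toReal ^ 2 ≤ W.trace := by
  have hA : IsStableMatrix A := isStableMatrix_of_posDef (P := P) <| by
    convert h₂.submatrix (e := Sum.map id Sum.inl)
      (Function.Injective.sumMap Function.injective_id Sum.inl_injective) using 1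
    ext (i | i) (j | j) <;> rfl
  have hP : P.PosDef := h₂.submatrix (e := Sum.inl) Sum.inl_injective
  have hPT : Pᵀ = P := hP.1
  have hdet := (isUnit_iff_isUnit_det _).1 hP.isUnit
  have hQT : P⁻¹ᵀ = P⁻¹ := by rw [transpose_nonsing_inv, hPT]
  refine hA.hTwoNorm_transferFunction hQT ?_ h₁.sub_mul_inv_mul_posSemidef
  -- the Schur complement is `P - P A P⁻¹ Aᵀ P - P B Bᵀ P`; multiply by `P⁻¹` on both sides
  have h := h₂.sub_mul_inv_mul_posSemidef.conjTranspose_mul_mul_same P⁻¹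
  convert h using 1
  rw [conjTranspose_eq_transpose_of_trivial, hQT]
  simp only [transpose_mul, hPT, Matrix.mul_sub, Matrix.sub_mul, Matrix.mul_assoc,
    mul_nonsing_inv P hdet, nonsing_inv_mul_cancel_left P _ hdet, Matrix.mul_one]

/-! ### The `H_∞` norm -/

theorem norm_toLp_sq_eq_re {a : Type*} [Fintype a] (v : a → ℂ) :
    ‖WithLp.toLp 2 v‖ ^ 2 = (star v ⬝ᵥ v).re := by
  rw [EuclideanSpace.norm_sq_eq]
  simp [dotProduct, Complex.conj_mul', ← Complex.ofReal_pow]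

theorem sigmaMax_le {m q : Type*} [Fintype q] [Fintype m] [DecidableEq m] {M : Matrix q m ℂ}
    {γ : ℝ} (h : ∀ u, (star (M *ᵥ u) ⬝ᵥ (M *ᵥ u)).re ≤ γ * (star u ⬝ᵥ u).re) :
    sigmaMax M ≤ √γ := by
  rw [sigmaMax, l2_opNorm_def]
  refine ContinuousLinearMap.opNorm_le_bound _ (Real.sqrt_nonneg _) fun u => ?_
  have h1 := h u.ofLp
  rw [← norm_toLp_sq_eq_re, ← norm_toLp_sq_eq_re, WithLp.toLp_ofLp] at h1
  have h2 := Real.sqrt_le_sqrt h1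
  rwa [Real.sqrt_sq (norm_nonneg _), Real.sqrt_mul' _ (sq_nonneg _),
    Real.sqrt_sq (norm_nonneg _)] at h2

/-- The bounded real lemma: the linear matrix inequality bounds the squared `H_∞` norm by `γ`, and
its Lyapunov part gives stability. -/
theorem hInfNorm_transferFunction_of_posDef {k m q : Type*} [Fintype k] [DecidableEq k]
    [Fintype m] [DecidableEq m] [Fintype q] [DecidableEq q] {A P : Matrix k k ℝ}
    {B : Matrix k m ℝ} {C : Matrix q k ℝ} {D : Matrix q m ℝ} {γ : ℝ} (hγ : 0 < γ)
    (h : (fromBlocks (fromBlocks P 0 0 (γ • 1)) (fromBlocks (P * A) (P * B) C D)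
      (fromBlocks (P * A) (P * B) C D)ᵀ (fromBlocks P 0 0 1)).PosDef) :
    IsStableMatrix A ∧ hInfNorm (transferFunction A B C D) ≠ ⊤ ∧
      (hInfNorm (transferFunction A B C D)).toReal ^ 2 ≤ γ := by
  have hA : IsStableMatrix A := isStableMatrix_of_posDef (P := P) <| by
    convert h.submatrix (e := Sum.map Sum.inl Sum.inl)
      (Function.Injective.sumMap Sum.inl_injective Sum.inl_injective) using 1
    ext (i | i) (j | j) <;> rfl
  have h' := h.map_ofReal.posSemidef
  have hs : (γ • (1 : Matrix q q ℝ)).map Complex.ofReal = (γ : ℂ) • 1 := by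
    rw [← map_ofReal_one]
    ext i j
    exact Complex.ofReal_mul _ _
  rw [fromBlocks_map, map_ofReal_transpose, fromBlocks_map, fromBlocks_map, fromBlocks_map,
    map_ofReal_mul, map_ofReal_mul, map_ofReal_zero, map_ofReal_zero, map_ofReal_zero,
    map_ofReal_zero, map_ofReal_one, hs] at h'
  have hle : hInfNorm (transferFunction A B C D) ≤ ENNReal.ofReal √γ := by
    refine essSup_le_of_ae_le _ (.of_forall fun ω => ENNReal.ofReal_le_ofReal (sigmaMax_le ?_))
    intro u
    have hz : ‖Complex.exp (ω * Complex.I)‖ = 1 := Complex.norm_exp_ofReal_mul_I ω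
    set z := Complex.exp (ω * Complex.I)
    have hu := (isUnit_iff_isUnit_det _).1 (hA.isUnit_smul_one_sub hz)
    set R := (z • (1 : Matrix k k ℂ) - A.map Complex.ofReal)⁻¹ with hR
    have hx : A.map Complex.ofReal *ᵥ (R *ᵥ (B.map Complex.ofReal *ᵥ u)) +
        B.map Complex.ofReal *ᵥ u = z • (R *ᵥ (B.map Complex.ofReal *ᵥ u)) := by
      have h1 : (z • (1 : Matrix k k ℂ) - A.map Complex.ofReal) *ᵥ
          (R *ᵥ (B.map Complex.ofReal *ᵥ u)) = B.map Complex.ofReal *ᵥ u := by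
        rw [mulVec_mulVec, hR, mul_nonsing_inv _ hu, one_mulVec]
      rw [sub_mulVec, smul_mulVec, one_mulVec] at h1
      rw [sub_eq_iff_eq_add] at h1
      rw [h1, add_comm]
    have h2 := re_star_dotProduct_le_of_posSemidef hγ h' hz hx
    have h3 : transferFunction A B C D z *ᵥ u = C.map Complex.ofReal *ᵥ
        (R *ᵥ (B.map Complex.ofReal *ᵥ u)) + D.map Complex.ofReal *ᵥ u := by
      rw [transferFunction, add_mulVec, mulVec_mulVec, mulVec_mulVec, ← hR]
    rwa [h3]
  refine ⟨hA, ne_top_of_le_ne_top ENNReal.ofReal_ne_top hle, ?_⟩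
  have h4 := ENNReal.toReal_le_of_le_ofReal (Real.sqrt_nonneg γ) hle
  calc _ ≤ √γ ^ 2 := by gcongr
    _ = γ := Real.sq_sqrt hγ.le

/-! ### Regrouping and transforming the linear matrix inequalities -/

section Regroup

variable {n m p q : Type*} [Fintype n] [DecidableEq n] [DecidableEq m] [Fintype p]
  [Fintype q] [DecidableEq q]
  {A : Matrix n n ℝ} {B : Matrix n m ℝ} {C : Matrix p n ℝ} {D : Matrix p m ℝ} {L : Matrix q n ℝ}
  {S : Matrix n n ℝ} {ρ μ lam : ℝ} {W : Matrix q q ℝ} {Y Z Fh : Matrix n n ℝ}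
  {Gh : Matrix n p ℝ} {Hh : Matrix q n ℝ} {Kh : Matrix q p ℝ}

/-- The first matrix inequality, with the blocks of the closed-loop state grouped. -/
theorem FilterLMI.output_posDef (h : FilterLMI A B C D L S ρ μ lam W Y Z Fh Gh Hh Kh) :
    (fromBlocks W (fromCols (fromCols (L - Kh * C - Hh) (L - Kh * C)) (-(Kh * D)))
      (fromCols (fromCols (L - Kh * C - Hh) (L - Kh * C)) (-(Kh * D)))ᵀ
      (fromBlocks (fromBlocks Z Z Zᵀ Y) 0 0 1)).PosDef := by
  convert h.2.1.submatrix (e := Sum.map id (Equiv.sumAssoc n n m))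
    (Function.Injective.sumMap Function.injective_id (Equiv.injective _)) using 1
  ext (i | (i | i) | i) (j | (j | j) | j) <;> rfl

/-- The second matrix inequality, with the blocks of the closed-loop state grouped. -/
theorem FilterLMI.gramian_posDef (h : FilterLMI A B C D L S ρ μ lam W Y Z Fh Gh Hh Kh) :
    (fromBlocks (fromBlocks Z Z Zᵀ Y)
      (fromCols (fromBlocks (Z * A) (Z * A) (Y * A + Gh * C + Fh) (Y * A + Gh * C))
        (fromRows (Z * B) (Y * B + Gh * D)))
      (fromCols (fromBlocks (Z * A) (Z * A) (Y * A + Gh * C + Fh) (Y * A + Gh * C))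
        (fromRows (Z * B) (Y * B + Gh * D)))ᵀ
      (fromBlocks (fromBlocks Z Z Zᵀ Y) 0 0 1)).PosDef := by
  convert h.2.2.1.submatrix
    (e := (Equiv.sumAssoc n n (n ⊕ n ⊕ m)) ∘ (Sum.map id (Equiv.sumAssoc n n m)))
    ((Equiv.injective _).comp
      (Function.Injective.sumMap Function.injective_id (Equiv.injective _))) using 1
  ext ((i | i) | (i | i) | i) ((j | j) | (j | j) | j) <;> rfl

/-- The third matrix inequality, with the blocks of the closed-loop state grouped. -/
theorem FilterLMI.sensitivity_posDef (h : FilterLMI A B C D L S ρ μ lam W Y Z Fh Gh Hh Kh) :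
    (fromBlocks (fromBlocks (fromBlocks Z Z Zᵀ Y) 0 0 ((lam / ρ ^ 2) • 1))
      (fromBlocks (fromBlocks 0 0 Fh 0) (fromRows 0 (Gh * C * S)) (fromCols Hh 0) (Kh * C * S))
      (fromBlocks (fromBlocks 0 0 Fh 0) (fromRows 0 (Gh * C * S)) (fromCols Hh 0) (Kh * C * S))ᵀ
      (fromBlocks (fromBlocks Z Z Zᵀ Y) 0 0 1)).PosDef := by
  convert h.2.2.2.submatrix
    (e := (Equiv.sumAssoc n n (q ⊕ n ⊕ n ⊕ n)) ∘ (Equiv.sumAssoc (n ⊕ n) q (n ⊕ n ⊕ n)) ∘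
      (Sum.map id (Equiv.sumAssoc n n n)))
    ((Equiv.injective _).comp ((Equiv.injective _).comp
      (Function.Injective.sumMap Function.injective_id (Equiv.injective _)))) using 1
  ext (((i | i) | i) | (i | i) | i) (((j | j) | j) | (j | j) | j) <;> rfl

theorem FilterLMI.fromBlocks_posDef (h : FilterLMI A B C D L S ρ μ lam W Y Z Fh Gh Hh Kh) :
    (fromBlocks Z Z Zᵀ Y).PosDef :=
  h.gramian_posDef.submatrix (e := Sum.inl) Sum.inl_injective

theorem FilterLMI.posDef_left (h : FilterLMI A B C D L S ρ μ lam W Y Z Fh Gh Hh Kh) : Z.PosDef :=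
  h.fromBlocks_posDef.submatrix (e := Sum.inl) Sum.inl_injective

theorem FilterLMI.div_sq_pos [Nonempty q]
    (h : FilterLMI A B C D L S ρ μ lam W Y Z Fh Gh Hh Kh) : 0 < lam / ρ ^ 2 := by
  obtain ⟨i⟩ := ‹Nonempty q›
  have := h.sensitivity_posDef.diag_pos (i := Sum.inl (Sum.inr i))
  simpa using this

/-- Testing `[[Z, Z], [Z, Y]] ≻ 0` at `(v, -v)`. -/
theorem FilterLMI.sub_posDef (h : FilterLMI A B C D L S ρ μ lam W Y Z Fh Gh Hh Kh) :
    (Y - Z).PosDef := by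
  have hZ : Zᵀ = Z := h.posDef_left.1
  have hinj : Function.Injective
      (fromRows (1 : Matrix n n ℝ) (-1 : Matrix n n ℝ)).mulVec := fun v w hvw => by
    have := congrArg (fun f => f ∘ Sum.inl) hvw
    simpa [fromRows_mulVec] using this
  have := h.fromBlocks_posDef.conjTranspose_mul_mul_same hinj
  rw [conjTranspose_eq_transpose_of_trivial, transpose_fromRows, fromCols_mul_fromBlocks,
    fromCols_mul_fromRows] at this
  simpa [hZ, sub_eq_neg_add, add_comm] using this

/-- The first two matrix inequalities are the `H₂` inequalities of the closed loop in the
coordinates `(v, w)` with `x = v + w` and `x̂ = T⁻¹ v`, where the Lyapunov matrix is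
`[[Z, Z], [Z, Y]]`. In the proof `E` is the change of coordinates `(x, x̂) ↦ (v, w)`, so that
`P = Eᵀ [[Z, Z], [Z, Y]] E` certifies the bound for `(x, x̂)`. -/
theorem FilterLMI.hTwoNorm_errorTransfer [Fintype m]
    (h : FilterLMI A B C D L S ρ μ lam W Y Z Fh Gh Hh Kh) {T T' V F : Matrix n n ℝ}
    {G : Matrix n p ℝ} (hT : T' * T = 1) (hV : (Z - Y) * T = V) (hF : V * F = Fh * T)
    (hG : V * G = Gh) :
    hTwoNorm (errorTransfer A B C D L F G (Hh * T) Kh) ≠ ⊤ ∧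
      (hTwoNorm (errorTransfer A B C D L F G (Hh * T) Kh)).toReal ^ 2 ≤ W.trace := by
  have hZ : Zᵀ = Z := h.posDef_left.1
  set E : Matrix (n ⊕ n) (n ⊕ n) ℝ := fromBlocks 0 T 1 (-T) with hE
  have hJE : fromBlocks 1 1 T' 0 * E = 1 := by
    rw [hE, fromBlocks_multiply]
    simp [hT]
  have hZE : fromBlocks Z Z Zᵀ Y * E = fromBlocks Z 0 Y V := by
    rw [hE, fromBlocks_multiply, hZ, ← hV]
    simp [Matrix.sub_mul, ← sub_eq_add_neg]
  have hE₂ : fromBlocks (fromBlocks 1 1 T' 0) 0 0 1 *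
      fromBlocks E 0 0 (1 : Matrix m m ℝ) = 1 := by
    rw [fromBlocks_multiply, hJE]
    simp
  have hΦ : fromBlocks (Z * A) (Z * A) (Y * A + Gh * C + Fh) (Y * A + Gh * C) * E =
      fromBlocks Z Z Zᵀ Y * E * fromBlocks A 0 (G * C) F := by
    rw [hZE, hE, fromBlocks_multiply, fromBlocks_multiply, ← Matrix.mul_assoc V, hF, hG]
    simp only [Matrix.add_mul, Matrix.mul_zero, Matrix.mul_one, Matrix.mul_neg,
      Matrix.zero_mul, zero_add, add_zero]
    congr 1 <;> abel
  have hΨ : fromRows (Z * B) (Y * B + Gh * D) =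
      fromBlocks Z Z Zᵀ Y * E * fromRows B (G * D) := by
    rw [hZE, fromBlocks_mul_fromRows, ← Matrix.mul_assoc V, hG]
    simp
  have hC : fromCols (L - Kh * C - Hh) (L - Kh * C) * E = fromCols (L - Kh * C) (-(Hh * T)) := by
    rw [hE, fromCols_mul_fromBlocks]
    simp only [Matrix.sub_mul, Matrix.mul_zero, Matrix.mul_one, Matrix.mul_neg, zero_add]
    congr 1
    abel
  have h₁ := h.output_posDef.fromBlocks_congr (one_mul (1 : Matrix q q ℝ)) hE₂
  have h₂ := h.gramian_posDef.fromBlocks_congr hJE hE₂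
  have hΦ' : Eᵀ * fromBlocks (Z * A) (Z * A) (Y * A + Gh * C + Fh) (Y * A + Gh * C) * E =
      Eᵀ * fromBlocks Z Z Zᵀ Y * E * fromBlocks A 0 (G * C) F := by
    rw [Matrix.mul_assoc, hΦ]
    simp only [Matrix.mul_assoc]
  have hΨ' : Eᵀ * fromRows (Z * B) (Y * B + Gh * D) =
      Eᵀ * fromBlocks Z Z Zᵀ Y * E * fromRows B (G * D) := by
    rw [hΨ]
    simp only [Matrix.mul_assoc]
  have hP : (fromBlocks E 0 0 (1 : Matrix m m ℝ))ᵀ *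
      fromBlocks (fromBlocks Z Z Zᵀ Y) 0 0 1 * fromBlocks E 0 0 1 =
      fromBlocks (Eᵀ * fromBlocks Z Z Zᵀ Y * E) 0 0 1 := by
    simp [fromBlocks_transpose, fromBlocks_multiply]
  rw [hP, mul_fromCols, fromCols_mul_fromBlocks, hΦ', Matrix.mul_one, Matrix.mul_zero,
    Matrix.mul_zero, add_zero, zero_add, hΨ'] at h₂
  rw [hP, transpose_one, Matrix.one_mul, Matrix.one_mul, Matrix.mul_one, fromCols_mul_fromBlocks,
    hC, Matrix.mul_one, Matrix.mul_zero, Matrix.mul_zero, add_zero, zero_add] at h₁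
  exact hTwoNorm_transferFunction_of_posDef h₁ h₂

/-- The third matrix inequality lives on the closed-loop state; restricted to the filter states
`(0, x̂)`, which have the coordinates `(T x̂, -T x̂)`, it becomes the bounded real inequality of the
realization of the sensitivity with state `x̂`. -/
theorem FilterLMI.sensitivity_fromBlocks_posDef
    (h : FilterLMI A B C D L S ρ μ lam W Y Z Fh Gh Hh Kh) {T T' V F : Matrix n n ℝ}
    {G : Matrix n p ℝ} (hT : T' * T = 1) (hV : (Z - Y) * T = V) (hF : V * F = Fh * T)
    (hG : V * G = Gh) :
    ∃ P : Matrix n n ℝ,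
      (fromBlocks (fromBlocks P 0 0 ((lam / ρ ^ 2) • 1))
        (fromBlocks (P * F) (P * (G * C * S)) (Hh * T) (Kh * C * S))
        (fromBlocks (P * F) (P * (G * C * S)) (Hh * T) (Kh * C * S))ᵀ
        (fromBlocks P 0 0 1)).PosDef := by
  have hZ : Zᵀ = Z := h.posDef_left.1
  set E : Matrix (n ⊕ n) n ℝ := fromRows T (-T) with hE
  have hJE : fromCols T' (0 : Matrix n n ℝ) * E = 1 := by
    rw [hE, fromCols_mul_fromRows]
    simp [hT]
  have hZE : fromBlocks Z Z Zᵀ Y * E = fromRows 0 V := by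
    rw [hE, fromBlocks_mul_fromRows, hZ, ← hV]
    simp [Matrix.sub_mul, ← sub_eq_add_neg]
  have hE₁ : fromBlocks (fromCols T' (0 : Matrix n n ℝ)) 0 0 (1 : Matrix q q ℝ) *
      fromBlocks E 0 0 (1 : Matrix q q ℝ) = 1 := by
    rw [fromBlocks_multiply, hJE]
    simp
  have hE₂ : fromBlocks (fromCols T' (0 : Matrix n n ℝ)) 0 0 (1 : Matrix n n ℝ) *
      fromBlocks E 0 0 (1 : Matrix n n ℝ) = 1 := by
    rw [fromBlocks_multiply, hJE]
    simp
  have hΦ : fromBlocks (0 : Matrix n n ℝ) (0 : Matrix n n ℝ) Fh 0 * E =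
      fromBlocks Z Z Zᵀ Y * E * F := by
    rw [hZE, hE, fromBlocks_mul_fromRows, fromRows_mul, hF]
    simp
  have hΨ : fromRows (0 : Matrix n n ℝ) (Gh * C * S) =
      fromBlocks Z Z Zᵀ Y * E * (G * C * S) := by
    rw [hZE, fromRows_mul, ← Matrix.mul_assoc V, ← Matrix.mul_assoc V, hG]
    simp
  have hH : fromCols Hh (0 : Matrix q n ℝ) * E = Hh * T := by
    rw [hE, fromCols_mul_fromRows]
    simp
  have h₃ := h.sensitivity_posDef.fromBlocks_congr hE₁ hE₂
  refine ⟨Eᵀ * fromBlocks Z Z Zᵀ Y * E, ?_⟩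
  have hΦ' : Eᵀ * fromBlocks (0 : Matrix n n ℝ) (0 : Matrix n n ℝ) Fh 0 * E =
      Eᵀ * fromBlocks Z Z Zᵀ Y * E * F := by
    rw [Matrix.mul_assoc, hΦ]
    simp only [Matrix.mul_assoc]
  have hΨ' : Eᵀ * fromRows (0 : Matrix n n ℝ) (Gh * C * S) =
      Eᵀ * fromBlocks Z Z Zᵀ Y * E * (G * C * S) := by
    rw [hΨ]
    simp only [Matrix.mul_assoc]
  convert h₃ using 1
  simp only [fromBlocks_transpose, fromBlocks_multiply, Matrix.mul_one, Matrix.one_mul,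
    Matrix.mul_zero, Matrix.zero_mul, add_zero, zero_add, transpose_zero, transpose_one, hΦ', hΨ', hH]

end Regroup

/-! ### The filter -/

theorem FilterLMI.filterConstraints {n m p q : Type*} [Fintype n] [DecidableEq n] [Fintype m]
    [DecidableEq m] [Fintype p] [Fintype q] [DecidableEq q] [Nonempty q]
    {A : Matrix n n ℝ} {B : Matrix n m ℝ} {C : Matrix p n ℝ} {D : Matrix p m ℝ}
    {L : Matrix q n ℝ} {S : Matrix n n ℝ} {ρ μ lam : ℝ} {W : Matrix q q ℝ} {Y Z Fh : Matrix n n ℝ}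
    {Gh : Matrix n p ℝ} {Hh : Matrix q n ℝ} {Kh : Matrix q p ℝ} (hρ : 0 < ρ)
    (h : FilterLMI A B C D L S ρ μ lam W Y Z Fh Gh Hh Kh) {U V : Matrix n n ℝ}
    (hU : IsUnit U) (hV : IsUnit V) (hVU : V * Uᵀ = 1 - Y * Z⁻¹) :
    FilterConstraints A B C D L S ρ μ lam
      (V⁻¹ * Fh * Z⁻¹ * Uᵀ⁻¹) (V⁻¹ * Gh) (Hh * Z⁻¹ * Uᵀ⁻¹) Kh := by
  have hZu := (isUnit_iff_isUnit_det _).1 h.posDef_left.isUnit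
  have hUu : IsUnit Uᵀ.det := by rw [det_transpose]; exact (isUnit_iff_isUnit_det _).1 hU
  have hVu := (isUnit_iff_isUnit_det _).1 hV
  -- the coordinate change of the closed loop is `T = Z⁻¹ U⁻ᵀ`, with inverse `Uᵀ Z`
  have hT : Uᵀ * Z * (Z⁻¹ * Uᵀ⁻¹) = 1 := by
    rw [Matrix.mul_assoc, mul_nonsing_inv_cancel_left Z _ hZu, mul_nonsing_inv _ hUu]
  have hVT : (Z - Y) * (Z⁻¹ * Uᵀ⁻¹) = V := by
    rw [← Matrix.mul_assoc, Matrix.sub_mul, mul_nonsing_inv _ hZu, ← hVU,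
      mul_nonsing_inv_cancel_right _ _ hUu]
  have hF : V * (V⁻¹ * Fh * Z⁻¹ * Uᵀ⁻¹) = Fh * (Z⁻¹ * Uᵀ⁻¹) := by
    simp only [Matrix.mul_assoc]
    rw [mul_nonsing_inv_cancel_left V _ hVu]
  have hG : V * (V⁻¹ * Gh) = Gh := mul_nonsing_inv_cancel_left V _ hVu
  have h2 := h.hTwoNorm_errorTransfer hT hVT hF hG
  obtain ⟨P, hP⟩ := h.sensitivity_fromBlocks_posDef hT hVT hF hG
  rw [← Matrix.mul_assoc Hh] at h2 hP
  obtain ⟨hF', hfin, hle⟩ := hInfNorm_transferFunction_of_posDef h.div_sq_pos hP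
  refine ⟨hF', ⟨h2.1, h2.2.trans h.1.le⟩, hfin, ?_⟩
  rwa [le_div_iff₀' (by positivity)] at hle

/-- The choice `V = 1` works because `1 - Y Z⁻¹ = -(Y - Z) Z⁻¹` and `Y - Z ≻ 0`. -/
theorem FilterLMI.exists_isUnit_mul_transpose {n m p q : Type*} [Fintype n] [DecidableEq n]
    [Fintype m] [DecidableEq m] [Fintype p] [Fintype q] [DecidableEq q]
    {A : Matrix n n ℝ} {B : Matrix n m ℝ} {C : Matrix p n ℝ} {D : Matrix p m ℝ}
    {L : Matrix q n ℝ} {S : Matrix n n ℝ} {ρ μ lam : ℝ} {W : Matrix q q ℝ} {Y Z Fh : Matrix n n ℝ}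
    {Gh : Matrix n p ℝ} {Hh : Matrix q n ℝ} {Kh : Matrix q p ℝ}
    (h : FilterLMI A B C D L S ρ μ lam W Y Z Fh Gh Hh Kh) :
    ∃ U V : Matrix n n ℝ, IsUnit U ∧ IsUnit V ∧ V * Uᵀ = 1 - Y * Z⁻¹ := by
  have hZu := (isUnit_iff_isUnit_det _).1 h.posDef_left.isUnit
  have h1 : 1 - Y * Z⁻¹ = -((Y - Z) * Z⁻¹) := by
    rw [Matrix.sub_mul, mul_nonsing_inv _ hZu, neg_sub]
  have h2 : IsUnit (1 - Y * Z⁻¹) := by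
    rw [h1]
    exact (h.sub_posDef.isUnit.mul (isUnit_nonsing_inv_iff.2 h.posDef_left.isUnit)).neg
  refine ⟨(1 - Y * Z⁻¹)ᵀ, 1, ?_, isUnit_one, by rw [transpose_transpose, Matrix.one_mul]⟩
  rwa [isUnit_transpose]

end

theorem mainTheorem3 {n m p q : Type*} [Fintype n] [DecidableEq n] [Fintype m] [DecidableEq m]
    [Fintype p] [Fintype q] [DecidableEq q] [Nonempty q]
    (A : Matrix n n ℝ) (B : Matrix n m ℝ) (C : Matrix p n ℝ) (D : Matrix p m ℝ) (L : Matrix q n ℝ)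
    (s : Finset n) (ρ μ lam : ℝ) (hA : IsStableMatrix A) (hρ : 0 < ρ) :
    ((∃ (W : Matrix q q ℝ) (Y Z Fh : Matrix n n ℝ) (Gh : Matrix n p ℝ) (Hh : Matrix q n ℝ)
        (Kh : Matrix q p ℝ),
        FilterLMI A B C D L (selectionMatrix s) ρ μ lam W Y Z Fh Gh Hh Kh) →
      ∃ (F : Matrix n n ℝ) (G : Matrix n p ℝ) (H : Matrix q n ℝ) (K : Matrix q p ℝ),
        FilterConstraints A B C D L (selectionMatrix s) ρ μ lam F G H K) ∧
    ∀ (W : Matrix q q ℝ) (Y Z Fh : Matrix n n ℝ) (Gh : Matrix n p ℝ) (Hh : Matrix q n ℝ)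
      (Kh : Matrix q p ℝ),
      FilterLMI A B C D L (selectionMatrix s) ρ μ lam W Y Z Fh Gh Hh Kh →
      (∃ U V : Matrix n n ℝ, IsUnit U ∧ IsUnit V ∧ V * Uᵀ = 1 - Y * Z⁻¹) ∧
      ∀ U V : Matrix n n ℝ, IsUnit U → IsUnit V → V * Uᵀ = 1 - Y * Z⁻¹ →
        FilterConstraints A B C D L (selectionMatrix s) ρ μ lam
          (V⁻¹ * Fh * Z⁻¹ * Uᵀ⁻¹) (V⁻¹ * Gh) (Hh * Z⁻¹ * Uᵀ⁻¹) Kh := by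
  refine ⟨?_, fun W Y Z Fh Gh Hh Kh h =>
    ⟨h.exists_isUnit_mul_transpose, fun U V hU hV hVU => h.filterConstraints hρ hU hV hVU⟩⟩
  rintro ⟨W, Y, Z, Fh, Gh, Hh, Kh, h⟩
  obtain ⟨U, V, hU, hV, hVU⟩ := h.exists_isUnit_mul_transpose
  exact ⟨_, _, _, _, h.filterConstraints hρ hU hV hVU⟩
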